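/- **Theorem 3 (Power-law Concentration).** Let $\lambda>0$, let $Q=(Q_j)_{j\ge1}$ be a probability measure on $\{1,2,\ldots\}$, and let $Z$ have the compound Poisson distribution $\mathrm{CP}(\lambda,Q)$, that is, the law of $\sum_{i=1}^W X_i$ where $W\sim\mathrm{Poisson}(\lambda)$ and the $X_i$ are independent with law $Q$ and independent of $W$. Assume that $$L=\sup\Big\{\tau\ge 1:\ \sum_{j\ge1}j^\tau Q_j<\infty\Big\}>1\qquad(L=\infty\text{ is allowed}),$$ and write $q_1=\sum_{j\ge1}jQ_j$, which is finite. Let $f:\{0,1,2,\ldots\}\to\mathbb R$ be $K$-Lipschitz, i.e. $|f(j+1)-f(j)|\le K$ for all $j\ge0$. Then $f(Z)$ is integrable. Let $t>0$ and $\epsilon>0$, and put $$T=2|f(0)|+2K\lambda q_1+\epsilon,\qquad C_{j,\epsilon}=1+\frac{jK}{\epsilon},\qquad I_\epsilon(\alpha)=\lambda\sum_{j\ge1}Q_j\big\{C_{j,\epsilon}^{\alpha}-1-\alpha\log C_{j,\epsilon}\big\}\quad(0<\alpha<L),$$ where the series converges. (i) With $\exp\{-\infty\}=0$, $$\Pr\{|f(Z)-Ef(Z)|>t\}\le\exp\Big\{\inf_{0<\alpha<L}\big[I_\epsilon(\alpha)+\alpha\log(T/t)\big]\Big\}.$$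 (ii) The upper bound in (i) is less than $1$ if and only if $t>T$. On $(0,L)$ the function $I_\epsilon$ is differentiable with derivative $$i_\epsilon(\alpha):=I_\epsilon'(\alpha)=\lambda\sum_{j\ge1}Q_j\big[C_{j,\epsilon}^{\alpha}-1\big]\log C_{j,\epsilon},$$ where the series converges. Let $i_\epsilon^{-1}(s)=\sup\{\alpha\in(0,L): i_\epsilon(\alpha)\le s\}\in[0,\infty]$ for $s>0$; if $K>0$, then $i_\epsilon^{-1}(i_\epsilon(\alpha))=\alpha$ for all $0<\alpha<L$, so this is the ordinary inverse on the range of $i_\epsilon$. If $t>T$, then the upper bound in (i) equals $$\exp\Big\{-\int_0^{\log(t/T)}i_\epsilon^{-1}(s)\,ds\Big\},$$ and in particular $\Pr\{|f(Z)-Ef(Z)|>t\}$ is at most this quantity. -/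

import Mathlib

open MeasureTheory ProbabilityTheory
open scoped NNReal ENNReal

noncomputable section

/-- The compound Poisson distribution `CP(lam, Q)`: the law of the random sum `X_1 + ⋯ + X_W`,
where `W` is Poisson with mean `lam`, and the `X_i` are i.i.d. with law `Q` and independent
of `W`. -/
def compoundPoisson (lam : ℝ≥0) (Q : Measure ℕ) [IsProbabilityMeasure Q] : Measure ℕ :=
  ((poissonMeasure lam).prod (Measure.infinitePi fun _ : ℕ => Q)).map
    fun p => ∑ i ∈ Finset.range p.1, p.2 i

/-- `L = sup {τ ≥ 1 : ∑_j j ^ τ Q_j < ∞}`, possibly infinite. -/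
def momentOrder (Q : Measure ℕ) : ℝ≥0∞ :=
  ⨆ (τ : ℝ) (_ : 1 ≤ τ ∧ Summable fun j : ℕ => (j : ℝ) ^ τ * Q.real {j}), ENNReal.ofReal τ

/-- The first moment `q_1 = ∑_j j Q_j`. -/
def firstMoment (Q : Measure ℕ) : ℝ := ∑' j : ℕ, (j : ℝ) * Q.real {j}

/-- `f` is `K`-Lipschitz on `ℤ_+`. -/
def IsLipschitzNat (K : ℝ) (f : ℕ → ℝ) : Prop := ∀ j : ℕ, |f (j + 1) - f j| ≤ K

/-- `C_{j,ε} = 1 + j K / ε`. -/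
def coeffC (K ε : ℝ) (j : ℕ) : ℝ := 1 + j * K / ε

/-- The `j`-th term `Q_j (C_{j,ε} ^ α - 1 - α log C_{j,ε})` of the series in `I_ε(α)`. -/
def rateTerm (Q : Measure ℕ) (K ε α : ℝ) (j : ℕ) : ℝ :=
  Q.real {j} * (coeffC K ε j ^ α - 1 - α * Real.log (coeffC K ε j))

/-- `I_ε(α) = lam ∑_j Q_j (C_{j,ε} ^ α - 1 - α log C_{j,ε})`. -/
def rateI (lam : ℝ≥0) (Q : Measure ℕ) (K ε α : ℝ) : ℝ := lam * ∑' j : ℕ, rateTerm Q K ε α j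

/-- The `j`-th term `Q_j (C_{j,ε} ^ α - 1) log C_{j,ε}` of the series in `i_ε(α)`. -/
def rateDerivTerm (Q : Measure ℕ) (K ε α : ℝ) (j : ℕ) : ℝ :=
  Q.real {j} * ((coeffC K ε j ^ α - 1) * Real.log (coeffC K ε j))

/-- `i_ε(α) = lam ∑_j Q_j (C_{j,ε} ^ α - 1) log C_{j,ε}`. -/
def rateDeriv (lam : ℝ≥0) (Q : Measure ℕ) (K ε α : ℝ) : ℝ :=
  lam * ∑' j : ℕ, rateDerivTerm Q K ε α j

/-- The inverse of the nondecreasing function `i_ε` on `(0, L)`: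
`i_ε⁻¹(s) = sup {α ∈ (0, L) : i_ε(α) ≤ s}`.  Where `i_ε` is strictly increasing this is the
ordinary inverse on the range of `i_ε`; it is `L` at every `s` above that range. -/
def rateDerivInv (lam : ℝ≥0) (Q : Measure ℕ) (K ε s : ℝ) : ℝ≥0∞ :=
  ⨆ (α : ℝ) (_ : 0 < α ∧ ENNReal.ofReal α < momentOrder Q ∧ rateDeriv lam Q K ε α ≤ s),
    ENNReal.ofReal α

/-- `T = 2 |f(0)| + 2 K lam q_1 + ε`, where `f0 = f(0)`. -/
def threshold (lam : ℝ≥0) (Q : Measure ℕ) (K ε f0 : ℝ) : ℝ :=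
  2 * |f0| + 2 * K * lam * firstMoment Q + ε

/-- The bound `exp {inf_{0 < α < L} [I_ε(α) + α log (T / t)]}`.  The infimum is taken in the
extended reals, because it is `-∞` (and the bound is `0`) when `K = 0`, `L = ∞` and `t > T`. -/
def powerBound (lam : ℝ≥0) (Q : Measure ℕ) (K ε f0 t : ℝ) : ℝ≥0∞ :=
  EReal.exp (⨅ (α : ℝ) (_ : 0 < α ∧ ENNReal.ofReal α < momentOrder Q),
    ((rateI lam Q K ε α + α * Real.log (threshold lam Q K ε f0 / t) : ℝ) : EReal))

/-- The bound `exp {- ∫_0^{log (t / T)} i_ε⁻¹(s) ds}`, for `t > T`. -/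
def integralBound (lam : ℝ≥0) (Q : Measure ℕ) (K ε f0 t : ℝ) : ℝ≥0∞ :=
  EReal.exp (-((∫⁻ s in Set.Ioc 0 (Real.log (t / threshold lam Q K ε f0)),
    rateDerivInv lam Q K ε s : ℝ≥0∞) : EReal))

end

/-! Let `S` average the shifts of a function over `Q`. The compound Poisson expectation is `exp (lam
(S - 1))` evaluated at `0`, hence the limit of `(1 + (lam / n) (S - 1)) ^ n`, that is, of `n` steps
of a lazy walk with jump probability `lam / n`. If `h` changes by at most `c j` under a shift by
`j`, one step costs a factor `exp (p * R)` with `R = ∑ Q_j (e ^ c_j - 1 - c_j)` and replaces `h` by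
its average, which satisfies the same increment bound (`lazyStep_exp_le`). Iteration and a limit
give `E e ^ h ≤ exp (E h + lam R)` (`lintegral_exp_compoundPoisson_le`).

The tail bound uses `h = α log (G / ε)` with `G = |f - E f| + ε`. Since `G ≥ ε`, the increments of
`h` are at most `α log C_j`, so `lam R` is `I_ε(α)`. Concavity of the logarithm gives `E h ≤ α log
(T / ε)`, and Markov's inequality concludes (`compoundPoisson_tail_le`).

For the integral form put `s₀ = log (t / T)`. As `i = I'` is nondecreasing, `sup (α s₀ - I(α))` is
the integral of the positive part of `s₀ - i` over `(0, L)`. This is the area of `{(s, a) : i(a) ≤ s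
≤ s₀}`; slicing it the other way gives the integral of `i⁻¹` (`lintegral_rateDerivInv`,
`iInf_rate_eq_neg_lintegral`). -/

/-! ### Averaging operators and compound Poisson expectations -/

/-- The operator averaging the shifts of a function over `Q`. -/
noncomputable def shiftAverage (Q : Measure ℕ) : Module.End ℝ≥0∞ (ℕ → ℝ≥0∞) where
  toFun h x := ∫⁻ j, h (x + j) ∂Q
  map_add' g h := by
    ext x
    exact lintegral_add_left (.of_discrete) _
  map_smul' c h := by
    ext x
    exact lintegral_const_mul _ (.of_discrete)

theorem shiftAverage_apply (Q : Measure ℕ) (h : ℕ → ℝ≥0∞) (x : ℕ) :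
    shiftAverage Q h x = ∫⁻ j, h (x + j) ∂Q := rfl

/-- One step of the lazy walk on `ℕ` that jumps with probability `p`, with jump law `Q`. -/
noncomputable def lazyStep (Q : Measure ℕ) (p : ℝ) : Module.End ℝ≥0∞ (ℕ → ℝ≥0∞) :=
  ENNReal.ofReal p • shiftAverage Q + ENNReal.ofReal (1 - p) • 1

theorem lazyStep_apply (Q : Measure ℕ) (p : ℝ) (h : ℕ → ℝ≥0∞) (x : ℕ) :
    lazyStep Q p h x
      = ENNReal.ofReal p * ∫⁻ j, h (x + j) ∂Q + ENNReal.ofReal (1 - p) * h x := rfl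

theorem lazyStep_mono (Q : Measure ℕ) (p : ℝ) {g h : ℕ → ℝ≥0∞} (hgh : g ≤ h) :
    lazyStep Q p g ≤ lazyStep Q p h := by
  intro x
  rw [lazyStep_apply, lazyStep_apply]
  gcongr
  · exact hgh _
  · exact hgh _

/-- The binomial theorem for commuting operators. The sum runs over all `k`, with zero terms for `k
> n`, so that it can be compared term by term with the Poisson series. -/
theorem lazyStep_pow_apply (Q : Measure ℕ) {p : ℝ} (hp0 : 0 ≤ p) (hp1 : p ≤ 1) (n : ℕ)
    (h : ℕ → ℝ≥0∞) (x : ℕ) :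
    (lazyStep Q p ^ n) h x
      = ∑' k, ENNReal.ofReal (n.choose k * p ^ k * (1 - p) ^ (n - k)) *
          (shiftAverage Q ^ k) h x := by
  have hcomm : Commute (ENNReal.ofReal p • shiftAverage Q)
      (ENNReal.ofReal (1 - p) • (1 : Module.End ℝ≥0∞ (ℕ → ℝ≥0∞))) :=
    ((Commute.one_right _).smul_right _)
  rw [tsum_eq_sum (s := Finset.range (n + 1)), lazyStep, hcomm.add_pow]
  · simp only [LinearMap.sum_apply, Finset.sum_apply]
    refine Finset.sum_congr rfl fun k _ => ?_
    rw [smul_pow, smul_pow, one_pow, ENNReal.ofReal_mul (by positivity),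
      ENNReal.ofReal_mul (by positivity), ENNReal.ofReal_pow hp0,
      ENNReal.ofReal_pow (by linarith), ENNReal.ofReal_natCast]
    rw [← nsmul_eq_mul']
    simp only [smul_mul_smul_comm, mul_one, LinearMap.smul_apply, Pi.smul_apply, smul_eq_mul]
    rw [nsmul_eq_mul]
    ring
  · intro k hk
    simp only [Finset.mem_range, not_lt] at hk
    simp [Nat.choose_eq_zero_of_lt (show n < k by omega)]

/-- The last summand is independent of the partial sum; integrating it out replaces `h` by its shift
average, hence the induction over all `h`. -/
theorem lintegral_infinitePi_sum_range (Q : Measure ℕ) [IsProbabilityMeasure Q] (h : ℕ → ℝ≥0∞)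
    (k x : ℕ) :
    ∫⁻ s, h (x + ∑ i ∈ Finset.range k, s i) ∂(Measure.infinitePi fun _ : ℕ => Q)
      = (shiftAverage Q ^ k) h x := by
  induction k generalizing h with
  | zero => simp
  | succ k ih =>
    have hind := (iIndepFun_infinitePi (P := fun _ : ℕ => Q) (X := fun _ => id)
      (fun _ => measurable_id)).indepFun_finsetSum_of_notMem
        (fun i => by fun_prop) (s := Finset.range k) (i := k) (by simp)
    have hlaw := (indepFun_iff_map_prod_eq_prod_map_map (by fun_prop)
      (measurable_pi_apply k).aemeasurable).1 hind
    have hk : (Measure.infinitePi fun _ : ℕ => Q).map (fun ω : ℕ → ℕ => ω k) = Q :=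
      Measure.infinitePi_map_eval (fun _ : ℕ => Q) k
    rw [hk] at hlaw
    rw [pow_succ, Module.End.mul_apply, ← ih (shiftAverage Q h)]
    simp only [Finset.sum_range_succ, shiftAverage_apply]
    calc _ = ∫⁻ q : ℕ × ℕ, h (x + (q.1 + q.2)) ∂((Measure.infinitePi fun _ : ℕ => Q).map
            fun ω => ((∑ j ∈ Finset.range k, fun ω : ℕ → ℕ => id (ω j)) ω, ω k)) := by
          rw [lintegral_map .of_discrete (by fun_prop)]
          simp
      _ = _ := by
          rw [hlaw, lintegral_prod _ (by fun_prop), lintegral_map .of_discrete (by fun_prop)]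
          simp [add_assoc]

theorem measurable_randomSum :
    Measurable fun p : ℕ × (ℕ → ℕ) => ∑ i ∈ Finset.range p.1, p.2 i :=
  measurable_from_prod_countable_right fun k =>
    Finset.measurable_fun_sum (Finset.range k) fun i _ => measurable_pi_apply i

theorem lintegral_compoundPoisson (lam : ℝ≥0) (Q : Measure ℕ) [IsProbabilityMeasure Q]
    (h : ℕ → ℝ≥0∞) :
    ∫⁻ z, h z ∂(compoundPoisson lam Q)
      = ∑' k : ℕ, ENNReal.ofReal (Real.exp (-lam) * lam ^ k / k.factorial) *
          (shiftAverage Q ^ k) h 0 := by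
  have hm : Measurable fun p : ℕ × (ℕ → ℕ) => h (∑ i ∈ Finset.range p.1, p.2 i) :=
    (Measurable.of_discrete (f := h)).comp measurable_randomSum
  rw [compoundPoisson, lintegral_map .of_discrete measurable_randomSum,
    lintegral_prod _ hm.aemeasurable, lintegral_countable']
  refine tsum_congr fun k => ?_
  rw [poissonMeasure_singleton, mul_comm, ← lintegral_infinitePi_sum_range]
  simp

instance (lam : ℝ≥0) (Q : Measure ℕ) [IsProbabilityMeasure Q] :
    IsProbabilityMeasure (compoundPoisson lam Q) :=
  Measure.isProbabilityMeasure_map measurable_randomSum.aemeasurable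

theorem shiftAverage_pow_le (Q : Measure ℕ) [IsProbabilityMeasure Q] {h c : ℕ → ℝ≥0∞}
    (hc : ∀ x j, h (x + j) ≤ h x + c j) (k x : ℕ) :
    (shiftAverage Q ^ k) h x ≤ h x + k * ∫⁻ j, c j ∂Q := by
  induction k generalizing x with
  | zero => simp
  | succ k ih =>
    rw [pow_succ', Module.End.mul_apply, shiftAverage_apply]
    calc _ ≤ ∫⁻ j, (h x + c j + k * ∫⁻ j, c j ∂Q) ∂Q :=
          lintegral_mono fun j => (ih _).trans (by gcongr; exact hc x j)
      _ = _ := by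
          rw [lintegral_add_right _ .of_discrete, lintegral_add_right _ .of_discrete]
          simp
          ring

theorem hasSum_poisson_mul_id (lam : ℝ≥0) :
    HasSum (fun k : ℕ => Real.exp (-lam) * lam ^ k / k.factorial * k) lam := by
  rw [← hasSum_nat_add_iff' 1]
  simp only [Finset.range_one, Finset.sum_singleton, Nat.cast_zero, mul_zero, sub_zero]
  have := (hasSum_one_poissonMeasure lam).mul_left (lam : ℝ)
  rw [mul_one] at this
  have e : ∀ k : ℕ, (lam : ℝ) * (Real.exp (-lam) * lam ^ k / k.factorial)
      = Real.exp (-lam) * lam ^ (k + 1) / (k + 1).factorial * ((k + 1 : ℕ) : ℝ) := fun k => by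
    rw [Nat.factorial_succ]
    push_cast
    field_simp
    ring
  simp only [e] at this
  exact this

/-- Each jump costs `∫ c` on average, and the mean number of jumps is `lam`. This gives the first
moment of `f(Z)`. -/
theorem lintegral_compoundPoisson_le (lam : ℝ≥0) (Q : Measure ℕ) [IsProbabilityMeasure Q]
    {h c : ℕ → ℝ≥0∞} (hc : ∀ x j, h (x + j) ≤ h x + c j) :
    ∫⁻ z, h z ∂(compoundPoisson lam Q) ≤ h 0 + lam * ∫⁻ j, c j ∂Q := by
  have h1 := (hasSum_one_poissonMeasure lam)
  have h2 := hasSum_poisson_mul_id lam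
  have e1 : ∑' k : ℕ, ENNReal.ofReal (Real.exp (-lam) * lam ^ k / k.factorial) = 1 := by
    rw [← ENNReal.ofReal_tsum_of_nonneg (fun _ => by positivity) h1.summable, h1.tsum_eq]
    simp
  have e2 : ∑' k : ℕ, ENNReal.ofReal (Real.exp (-lam) * lam ^ k / k.factorial) * (k : ℝ≥0∞)
      = lam := by
    have : ∀ k : ℕ, ENNReal.ofReal (Real.exp (-lam) * lam ^ k / k.factorial) * (k : ℝ≥0∞)
        = ENNReal.ofReal (Real.exp (-lam) * lam ^ k / k.factorial * k) := fun k => by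
      rw [ENNReal.ofReal_mul (by positivity), ENNReal.ofReal_natCast]
    simp_rw [this]
    rw [← ENNReal.ofReal_tsum_of_nonneg (fun _ => by positivity) h2.summable, h2.tsum_eq]
    simp
  rw [lintegral_compoundPoisson]
  calc _ ≤ ∑' k : ℕ, (ENNReal.ofReal (Real.exp (-lam) * lam ^ k / k.factorial) * h 0 +
        ENNReal.ofReal (Real.exp (-lam) * lam ^ k / k.factorial) * k * ∫⁻ j, c j ∂Q) :=
        ENNReal.tsum_le_tsum fun k => by
          rw [mul_assoc, ← mul_add]
          gcongr
          exact shiftAverage_pow_le Q hc k 0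
    _ = _ := by
        rw [ENNReal.tsum_add, ENNReal.tsum_mul_right, ENNReal.tsum_mul_right, e1, e2, one_mul]

/-! ### Exponential moments along the lazy walk -/

/-- The function `e ^ x - 1 - x` increases on `x ≥ 0`, and its value at `-x` is no larger than at
`x` because `x ≤ sinh x`. -/
theorem exp_sub_one_sub_le {d c : ℝ} (h : |d| ≤ c) :
    Real.exp d - 1 - d ≤ Real.exp c - 1 - c := by
  rcases le_total 0 d with hd | hd
  · rw [abs_of_nonneg hd] at h
    have h1 : 1 ≤ Real.exp d := Real.one_le_exp hd
    have h2 := Real.add_one_le_exp (c - d)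
    have h3 : Real.exp c = Real.exp d * Real.exp (c - d) := by rw [← Real.exp_add]; ring_nf
    rw [h3]
    nlinarith
  · rw [abs_of_nonpos hd] at h
    have h0 : Real.exp d - 1 - d ≤ Real.exp (-d) - 1 - -d := by
      have := Real.self_le_sinh_iff.2 (neg_nonneg.2 hd)
      rw [Real.sinh_eq, neg_neg] at this
      linarith
    have h1 : 1 ≤ Real.exp (-d) := Real.one_le_exp (by linarith)
    have h2 := Real.add_one_le_exp (c - -d)
    have h3 : Real.exp c = Real.exp (-d) * Real.exp (c - -d) := by rw [← Real.exp_add]; ring_nf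
    rw [h3] at *
    nlinarith

/-- Write `e ^ d = 1 + d + (e ^ d - 1 - d)` with `d = h (x + j) - h x`. The linear part averages to
exactly `g x - h x`, the remainder is controlled by `c`, and `1 + u ≤ e ^ u` restores an
exponential. Averaging commutes with shifts, so `g` inherits the increment bound and the step can be
iterated. -/
theorem lazyStep_exp_le {Q : Measure ℕ} [IsProbabilityMeasure Q] {c : ℕ → ℝ}
    (hc : Integrable (fun j => Real.exp (c j)) Q) {p : ℝ} (hp0 : 0 ≤ p) (hp1 : p ≤ 1)
    {h : ℕ → ℝ} (h0 : ∀ x, 0 ≤ h x) (hh : ∀ x j, |h (x + j) - h x| ≤ c j) :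
    ∃ g : ℕ → ℝ, (∀ x, 0 ≤ g x) ∧ (∀ x j, |g (x + j) - g x| ≤ c j) ∧
      (lazyStep Q p (fun x => ENNReal.ofReal (h x)) = fun x => ENNReal.ofReal (g x)) ∧
      lazyStep Q p (fun x => ENNReal.ofReal (Real.exp (h x))) ≤
        fun x => ENNReal.ofReal (Real.exp (g x + p * ∫ j, (Real.exp (c j) - 1 - c j) ∂Q)) := by
  have c0 : ∀ j, 0 ≤ c j := fun j => (abs_nonneg _).trans (hh 0 j)
  have ci : Integrable c Q := hc.mono .of_discrete (.of_forall fun j => by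
    rw [Real.norm_of_nonneg (c0 j), Real.norm_of_nonneg (Real.exp_pos _).le]
    linarith [Real.add_one_le_exp (c j)])
  have di : ∀ x, Integrable (fun j => h (x + j) - h x) Q := fun x =>
    ci.mono' .of_discrete (.of_forall fun j => hh x j)
  have hi : ∀ x, Integrable (fun j => h (x + j)) Q := fun x => by
    refine ((di x).add (integrable_const (h x))).congr (.of_forall fun j => ?_)
    simp
  have edi : ∀ x, Integrable (fun j => Real.exp (h (x + j) - h x)) Q := fun x =>
    hc.mono .of_discrete (.of_forall fun j => by
      rw [Real.norm_of_nonneg (Real.exp_pos _).le, Real.norm_of_nonneg (Real.exp_pos _).le]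
      exact Real.exp_le_exp.2 ((le_abs_self _).trans (hh x j)))
  have ehi : ∀ x, Integrable (fun j => Real.exp (h (x + j))) Q := fun x => by
    have := (edi x).const_mul (Real.exp (h x))
    simpa [← Real.exp_add] using this
  have nn : ∀ x, 0 ≤ p * ∫ j, h (x + j) ∂Q := fun x =>
    mul_nonneg hp0 (integral_nonneg fun j => h0 _)
  have nn' : ∀ x, 0 ≤ (1 - p) * h x := fun x => mul_nonneg (by linarith) (h0 x)
  refine ⟨fun x => p * ∫ j, h (x + j) ∂Q + (1 - p) * h x, fun x => add_nonneg (nn x) (nn' x),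
    fun x j => ?_, ?_, fun x => ?_⟩
  · have e : p * ∫ i, h (x + j + i) ∂Q + (1 - p) * h (x + j) -
        (p * ∫ i, h (x + i) ∂Q + (1 - p) * h x)
        = p * ∫ i, (h (x + i + j) - h (x + i)) ∂Q + (1 - p) * (h (x + j) - h x) := by
      have := hi (x + j)
      simp_rw [add_right_comm x j] at this ⊢
      rw [integral_sub this (hi x)]
      ring
    have b : |∫ i, (h (x + i + j) - h (x + i)) ∂Q| ≤ c j := by
      have := norm_integral_le_of_norm_le_const (μ := Q)
        (f := fun i => h (x + i + j) - h (x + i)) (.of_forall fun i => hh (x + i) j)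
      simpa using this
    simp only
    rw [e]
    calc _ ≤ _ := abs_add_le _ _
      _ ≤ p * c j + (1 - p) * c j := by
        rw [abs_mul, abs_mul, abs_of_nonneg hp0, abs_of_nonneg (by linarith : 0 ≤ 1 - p)]
        gcongr
        exact hh x j
      _ = c j := by ring
  · ext x
    rw [lazyStep_apply, ← ofReal_integral_eq_lintegral_ofReal (hi x) (.of_forall fun j => h0 _),
      ← ENNReal.ofReal_mul hp0, ← ENNReal.ofReal_mul (by linarith),
      ← ENNReal.ofReal_add (nn x) (nn' x)]
  · rw [lazyStep_apply, ← ofReal_integral_eq_lintegral_ofReal (ehi x)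
        (.of_forall fun j => (Real.exp_pos _).le), ← ENNReal.ofReal_mul hp0,
      ← ENNReal.ofReal_mul (by linarith), ← ENNReal.ofReal_add
        (mul_nonneg hp0 (integral_nonneg fun j => (Real.exp_pos _).le))
        (mul_nonneg (by linarith) (Real.exp_pos _).le)]
    refine ENNReal.ofReal_le_ofReal ?_
    have e1 : ∫ j, Real.exp (h (x + j)) ∂Q
        = Real.exp (h x) * (1 + ∫ j, (Real.exp (h (x + j) - h x) - 1) ∂Q) := by
      rw [integral_sub (edi x) (integrable_const _)]
      simp only [integral_const, probReal_univ, smul_eq_mul, mul_one, add_sub_cancel,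
        ← integral_const_mul, ← Real.exp_add]
    have e2 : ∫ j, (Real.exp (h (x + j) - h x) - 1) ∂Q
        ≤ ∫ j, (h (x + j) - h x) ∂Q + ∫ j, (Real.exp (c j) - 1 - c j) ∂Q := by
      have ri : Integrable (fun j => Real.exp (c j) - 1 - c j) Q :=
        (hc.sub (integrable_const _)).sub ci
      rw [← integral_add (di x) ri]
      refine integral_mono ((edi x).sub (integrable_const _)) ((di x).add ri) fun j => ?_
      have := exp_sub_one_sub_le (hh x j)
      simp only
      linarith
    have e3 : ∫ j, (h (x + j) - h x) ∂Q = ∫ j, h (x + j) ∂Q - h x := by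
      rw [integral_sub (hi x) (integrable_const _)]
      simp
    rw [e3] at e2
    have e4 : p * ∫ j, h (x + j) ∂Q + (1 - p) * h x +
          p * ∫ j, (Real.exp (c j) - 1 - c j) ∂Q
        = h x + p * (∫ j, h (x + j) ∂Q - h x + ∫ j, (Real.exp (c j) - 1 - c j) ∂Q) := by ring
    rw [e1, e4, Real.exp_add]
    calc _ = Real.exp (h x) * (p * ∫ j, (Real.exp (h (x + j) - h x) - 1) ∂Q + 1) := by ring
      _ ≤ _ := by
        gcongr
        exact (Real.add_one_le_exp _).trans (Real.exp_le_exp.2 (by gcongr))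

theorem lazyStep_pow_exp_le {Q : Measure ℕ} [IsProbabilityMeasure Q] {c : ℕ → ℝ}
    (hc : Integrable (fun j => Real.exp (c j)) Q) {p : ℝ} (hp0 : 0 ≤ p) (hp1 : p ≤ 1)
    {h : ℕ → ℝ} (h0 : ∀ x, 0 ≤ h x) (hh : ∀ x j, |h (x + j) - h x| ≤ c j) (n : ℕ) :
    ∃ g : ℕ → ℝ, (∀ x, 0 ≤ g x) ∧ (∀ x j, |g (x + j) - g x| ≤ c j) ∧
      ((lazyStep Q p ^ n) (fun x => ENNReal.ofReal (h x)) = fun x => ENNReal.ofReal (g x)) ∧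
      (lazyStep Q p ^ n) (fun x => ENNReal.ofReal (Real.exp (h x))) ≤
        fun x => ENNReal.ofReal
          (Real.exp (g x + n * p * ∫ j, (Real.exp (c j) - 1 - c j) ∂Q)) := by
  induction n with
  | zero => exact ⟨h, h0, hh, by simp, by simp⟩
  | succ n ih =>
    obtain ⟨g, g0, hg, hgl, hge⟩ := ih
    obtain ⟨g', g0', hg', hgl', hge'⟩ := lazyStep_exp_le hc hp0 hp1 g0 hg
    refine ⟨g', g0', hg', ?_, ?_⟩
    · rw [pow_succ', Module.End.mul_apply, hgl, hgl']
    · rw [pow_succ', Module.End.mul_apply]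
      refine (lazyStep_mono Q p hge).trans ?_
      set R := ∫ j, (Real.exp (c j) - 1 - c j) ∂Q
      -- The accumulated error does not depend on `x`, so by linearity it passes through the next
      -- step as a scalar.
      have e : (fun x => ENNReal.ofReal (Real.exp (g x + n * p * R)))
          = ENNReal.ofReal (Real.exp (n * p * R)) • fun x => ENNReal.ofReal (Real.exp (g x)) := by
        ext x
        rw [add_comm, Real.exp_add, ENNReal.ofReal_mul (Real.exp_pos _).le]
        rfl
      rw [e, map_smul]
      intro x
      refine (mul_le_mul_right (hge' x) _).trans_eq ?_
      rw [← ENNReal.ofReal_mul (Real.exp_pos _).le, ← Real.exp_add]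
      congr 2
      push_cast
      ring

/-! ### Poisson limit of the lazy walk -/

open Filter Topology in
theorem tendsto_binomial_weight (lam : ℝ≥0) (k : ℕ) :
    Tendsto (fun n : ℕ => ENNReal.ofReal
        (n.choose k * ((lam : ℝ) / n) ^ k * (1 - (lam : ℝ) / n) ^ (n - k))) atTop
      (𝓝 (ENNReal.ofReal (Real.exp (-lam) * lam ^ k / k.factorial))) := by
  refine ENNReal.tendsto_ofReal (tendsto_choose_mul_pow_of_tendsto_mul_atTop k ?_)
  refine tendsto_const_nhds.congr' ?_
  filter_upwards [eventually_gt_atTop 0] with n hn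
  field_simp

open Filter in
theorem eventually_div_le_one (lam : ℝ≥0) : ∀ᶠ n : ℕ in atTop, (lam : ℝ) / n ≤ 1 := by
  filter_upwards [eventually_gt_atTop 0, eventually_ge_atTop ⌈(lam : ℝ)⌉₊] with n hn hl
  rw [div_le_one (by exact_mod_cast hn)]
  exact (Nat.le_ceil _).trans (by exact_mod_cast hl)

open Filter Topology in
theorem tendsto_lazyStep_pow {lam : ℝ≥0} (hlam : 0 < lam) (Q : Measure ℕ) [IsProbabilityMeasure Q]
    {h : ℕ → ℝ≥0∞} (hfin : ∫⁻ z, h z ∂(compoundPoisson lam Q) ≠ ∞) :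
    Tendsto (fun n : ℕ => (lazyStep Q (lam / n) ^ n) h 0) atTop
      (𝓝 (∫⁻ z, h z ∂(compoundPoisson lam Q))) := by
  have key : Tendsto (fun n : ℕ => ∫⁻ k, ENNReal.ofReal
        (n.choose k * ((lam : ℝ) / n) ^ k * (1 - (lam : ℝ) / n) ^ (n - k)) *
          (shiftAverage Q ^ k) h 0 ∂Measure.count) atTop
      (𝓝 (∫⁻ k, ENNReal.ofReal (Real.exp (-lam) * lam ^ k / k.factorial) *
          (shiftAverage Q ^ k) h 0 ∂Measure.count)) := by
    -- The binomial weights are at most `lam ^ k / k!`, which is `e ^ lam` times the Poisson weight.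
    refine tendsto_lintegral_filter_of_dominated_convergence (fun k : ℕ =>
      ENNReal.ofReal (Real.exp lam) * (ENNReal.ofReal (Real.exp (-lam) * lam ^ k / k.factorial) *
          (shiftAverage Q ^ k) h 0)) (.of_forall fun n => .of_discrete) ?_ ?_ ?_
    · filter_upwards [eventually_gt_atTop 0, eventually_div_le_one lam] with n hn hl
      refine .of_forall fun k => ?_
      rw [← mul_assoc, ← ENNReal.ofReal_mul (Real.exp_pos _).le]
      refine mul_le_mul_left (ENNReal.ofReal_le_ofReal ?_) _
      have h1 : (1 - (lam : ℝ) / n) ^ (n - k) ≤ 1 :=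
        pow_le_one₀ (by linarith) (by linarith [show 0 ≤ (lam : ℝ) / n by positivity])
      have h2 : (n.choose k : ℝ) ≤ (n : ℝ) ^ k / k.factorial := Nat.choose_le_pow_div k n
      have hn' : (n : ℝ) ≠ 0 := by positivity
      calc _ ≤ (n : ℝ) ^ k / k.factorial * ((lam : ℝ) / n) ^ k * 1 := by
            have : 0 ≤ 1 - (lam : ℝ) / n := by linarith
            gcongr
        _ = Real.exp lam * Real.exp (-lam) * (lam ^ k / k.factorial) := by
            rw [← Real.exp_add, div_pow]
            field_simp
            simp
        _ = _ := by ring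
    · rw [lintegral_const_mul _ .of_discrete, lintegral_count, ← lintegral_compoundPoisson]
      exact ENNReal.mul_ne_top ENNReal.ofReal_ne_top hfin
    · refine .of_forall fun k => ?_
      refine ENNReal.Tendsto.mul_const (tendsto_binomial_weight lam k) (.inl ?_)
      exact (ENNReal.ofReal_pos.2 (by positivity)).ne'
  simp only [lintegral_count, ← lintegral_compoundPoisson] at key
  refine key.congr' ?_
  filter_upwards [eventually_div_le_one lam] with n hn
  rw [lazyStep_pow_apply Q (by positivity) hn]

open Filter Topology in
-- Fatou's lemma, with no finiteness assumption: it is applied to `e ^ h`, whose integrability is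
-- not known beforehand.
theorem lintegral_compoundPoisson_le_liminf {lam : ℝ≥0} (hlam : 0 < lam) (Q : Measure ℕ) [IsProbabilityMeasure Q]
    (h : ℕ → ℝ≥0∞) :
    ∫⁻ z, h z ∂(compoundPoisson lam Q)
      ≤ liminf (fun n : ℕ => (lazyStep Q (lam / n) ^ n) h 0) atTop := by
  have e : liminf (fun n : ℕ => (lazyStep Q (lam / n) ^ n) h 0) atTop
      = liminf (fun n : ℕ => ∫⁻ k, ENNReal.ofReal
        (n.choose k * ((lam : ℝ) / n) ^ k * (1 - (lam : ℝ) / n) ^ (n - k)) *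
          (shiftAverage Q ^ k) h 0 ∂Measure.count) atTop := by
    refine liminf_congr ?_
    filter_upwards [eventually_div_le_one lam] with n hn
    rw [lazyStep_pow_apply Q (by positivity) hn, lintegral_count]
  rw [e]
  refine le_trans ?_ (lintegral_liminf_le fun n => .of_discrete)
  rw [lintegral_compoundPoisson, ← lintegral_count]
  refine lintegral_mono fun k => ?_
  exact (ENNReal.Tendsto.mul_const (tendsto_binomial_weight lam k)
    (.inl (ENNReal.ofReal_pos.2 (by positivity)).ne')).liminf_eq.ge

open Filter Topology in
/-- A modified exponential moment bound: if `h` varies by at most `c j` under a shift by `j`, then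
`E e^h ≤ exp (E h + lam ∑ Q_j (e ^ c_j - 1 - c_j))` under the compound Poisson law. -/
theorem lintegral_exp_compoundPoisson_le {lam : ℝ≥0} (hlam : 0 < lam) (Q : Measure ℕ) [IsProbabilityMeasure Q]
    {c : ℕ → ℝ} (hc : Integrable (fun j => Real.exp (c j)) Q)
    {h : ℕ → ℝ} (h0 : ∀ x, 0 ≤ h x) (hh : ∀ x j, |h (x + j) - h x| ≤ c j)
    (hi : Integrable h (compoundPoisson lam Q)) :
    ∫⁻ z, ENNReal.ofReal (Real.exp (h z)) ∂(compoundPoisson lam Q) ≤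
      ENNReal.ofReal (Real.exp (∫ z, h z ∂(compoundPoisson lam Q) +
        lam * ∫ j, (Real.exp (c j) - 1 - c j) ∂Q)) := by
  refine (lintegral_compoundPoisson_le_liminf hlam Q _).trans ?_
  set R := ∫ j, (Real.exp (c j) - 1 - c j) ∂Q
  have hint := ofReal_integral_eq_lintegral_ofReal hi (.of_forall h0)
  -- The exponent needs a true limit: the averages of `h` itself converge to its mean because `h` is
  -- integrable.
  have hlim := tendsto_lazyStep_pow hlam Q (h := fun x => ENNReal.ofReal (h x))
    (by rw [← hint]; exact ENNReal.ofReal_ne_top)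
  have hlim' := (ENNReal.tendsto_toReal (by rw [← hint]; exact ENNReal.ofReal_ne_top)).comp hlim
  rw [← hint, ENNReal.toReal_ofReal (integral_nonneg h0)] at hlim'
  have hlim2 := (ENNReal.continuous_ofReal.comp Real.continuous_exp).continuousAt.tendsto.comp
    (hlim'.add_const (lam * R))
  refine le_trans (liminf_le_liminf ?_) hlim2.liminf_eq.le
  filter_upwards [eventually_gt_atTop 0, eventually_div_le_one lam] with n hn hl
  obtain ⟨g, g0, -, hgl, hge⟩ := lazyStep_pow_exp_le hc (by positivity) hl h0 hh n
  refine (hge 0).trans_eq ?_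
  have hn' : (n : ℝ) ≠ 0 := by positivity
  simp only [Function.comp_apply, hgl]
  rw [ENNReal.toReal_ofReal (g0 0), mul_div_cancel₀ _ hn']

/-! ### The rate function and its derivative -/

theorem one_le_coeffC {K ε : ℝ} (hK : 0 ≤ K) (hε : 0 < ε) (j : ℕ) : 1 ≤ coeffC K ε j := by
  have : 0 ≤ j * K / ε := by positivity
  rw [coeffC]
  linarith

/-- The strict gap between `α` and a finite moment `τ` is what later absorbs logarithmic factors. -/
theorem exists_moment_gt {Q : Measure ℕ} {α : ℝ} (hα : ENNReal.ofReal α < momentOrder Q) :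
    ∃ τ : ℝ, 1 ≤ τ ∧ α < τ ∧ Summable fun j : ℕ => (j : ℝ) ^ τ * Q.real {j} := by
  obtain ⟨τ, hτ⟩ := lt_iSup_iff.1 hα
  obtain ⟨h, hlt⟩ := lt_iSup_iff.1 hτ
  exact ⟨τ, h.1, (ENNReal.ofReal_lt_ofReal_iff (by linarith [h.1])).1 hlt, h.2⟩

theorem measureReal_eq_zero {Q : Measure ℕ} (hQ : Q {0} = 0) : Q.real {0} = 0 := by
  simp [Measure.real, hQ]

theorem summable_firstMoment {Q : Measure ℕ} (hQ : Q {0} = 0) (hL : 1 < momentOrder Q) :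
    Summable fun j : ℕ => (j : ℝ) * Q.real {j} := by
  obtain ⟨τ, h1, -, hs⟩ := exists_moment_gt (Q := Q) (α := 1) (by simpa using hL)
  refine Summable.of_nonneg_of_le (fun j => by positivity) (fun j => ?_) hs
  rcases Nat.eq_zero_or_pos j with rfl | hj
  · simp [measureReal_eq_zero hQ]
  · gcongr
    exact Real.self_le_rpow_of_one_le (by exact_mod_cast hj) h1

theorem summable_coeffC_rpow {Q : Measure ℕ} (hQ : Q {0} = 0) {K ε : ℝ} (hK : 0 ≤ K) (hε : 0 < ε)
    {τ : ℝ} (hτ : 0 ≤ τ) (hs : Summable fun j : ℕ => (j : ℝ) ^ τ * Q.real {j}) :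
    Summable fun j : ℕ => Q.real {j} * coeffC K ε j ^ τ := by
  refine Summable.of_nonneg_of_le (fun j => ?_) (fun j => ?_) (hs.mul_left ((1 + K / ε) ^ τ))
  · have := one_le_coeffC hK hε j
    positivity
  · rcases Nat.eq_zero_or_pos j with rfl | hj
    · simp [measureReal_eq_zero hQ]
    · have h1 := one_le_coeffC hK hε j
      have h2 : coeffC K ε j ≤ (1 + K / ε) * j := by
        have : (1 : ℝ) ≤ j := by exact_mod_cast hj
        rw [coeffC, add_mul, mul_div_assoc, mul_comm (j : ℝ)]
        linarith
      calc _ ≤ Q.real {j} * ((1 + K / ε) * j) ^ τ := by gcongr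
        _ = _ := by
          rw [Real.mul_rpow (by positivity) (by positivity)]
          ring

/-- The logarithm is paid for by the power `τ - β`. The bound is uniform in `a ≤ β`, as termwise
differentiation requires. -/
theorem abs_rateDerivTerm_le (Q : Measure ℕ) {K ε : ℝ} (hK : 0 ≤ K) (hε : 0 < ε)
    {a β τ : ℝ} (hab : a ≤ β) (hβ : 0 ≤ β) (hβτ : β < τ) (j : ℕ) :
    |rateDerivTerm Q K ε a j| ≤ 2 / (τ - β) * (Q.real {j} * coeffC K ε j ^ τ) := by
  have h1 := one_le_coeffC hK hε j
  have hlog : Real.log (coeffC K ε j) ≤ coeffC K ε j ^ (τ - β) / (τ - β) :=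
    Real.log_le_rpow_div (by linarith) (by linarith)
  have hlog0 := Real.log_nonneg h1
  have hb1 : 1 ≤ coeffC K ε j ^ β := Real.one_le_rpow h1 hβ
  have hab' : coeffC K ε j ^ a ≤ coeffC K ε j ^ β := Real.rpow_le_rpow_of_exponent_le h1 hab
  have ha0 : 0 < coeffC K ε j ^ a := by positivity
  have hd : |coeffC K ε j ^ a - 1| ≤ 2 * coeffC K ε j ^ β := abs_le.2 ⟨by linarith, by linarith⟩
  rw [rateDerivTerm, abs_mul, abs_mul, abs_of_nonneg hlog0, abs_of_nonneg measureReal_nonneg]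
  calc _ ≤ Q.real {j} * (2 * coeffC K ε j ^ β * (coeffC K ε j ^ (τ - β) / (τ - β))) := by gcongr
    _ = 2 / (τ - β) * (Q.real {j} * (coeffC K ε j ^ β * coeffC K ε j ^ (τ - β))) := by ring
    _ = _ := by rw [← Real.rpow_add (by linarith), add_sub_cancel]

theorem summable_rateDerivTerm {Q : Measure ℕ} (hQ : Q {0} = 0) {K ε : ℝ} (hK : 0 ≤ K)
    (hε : 0 < ε) {α : ℝ} (hα : ENNReal.ofReal α < momentOrder Q) :
    Summable (rateDerivTerm Q K ε α) := by
  obtain ⟨τ, h1, h2, hs⟩ := exists_moment_gt hα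
  exact Summable.of_norm_bounded ((summable_coeffC_rpow hQ hK hε (by linarith) hs).mul_left _)
    (abs_rateDerivTerm_le Q hK hε (le_max_left α 0) (le_max_right α 0)
      (max_lt h2 (by linarith)))

theorem rateTerm_zero (Q : Measure ℕ) (K ε : ℝ) : rateTerm Q K ε 0 = 0 := by
  ext j
  simp [rateTerm]

theorem rateI_zero (lam : ℝ≥0) (Q : Measure ℕ) (K ε : ℝ) : rateI lam Q K ε 0 = 0 := by
  simp [rateI, rateTerm_zero]

theorem rateDeriv_zero (lam : ℝ≥0) (Q : Measure ℕ) (K ε : ℝ) : rateDeriv lam Q K ε 0 = 0 := by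
  simp [rateDeriv, rateDerivTerm]

theorem rateTerm_nonneg (Q : Measure ℕ) {K ε : ℝ} (hK : 0 ≤ K) (hε : 0 < ε) (α : ℝ) (j : ℕ) :
    0 ≤ rateTerm Q K ε α j := by
  refine mul_nonneg measureReal_nonneg ?_
  rw [Real.rpow_def_of_pos (by linarith [one_le_coeffC hK hε j])]
  linarith [Real.add_one_le_exp (Real.log (coeffC K ε j) * α)]

theorem rateI_nonneg (lam : ℝ≥0) (Q : Measure ℕ) {K ε : ℝ} (hK : 0 ≤ K) (hε : 0 < ε) (α : ℝ) :
    0 ≤ rateI lam Q K ε α :=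
  mul_nonneg lam.2 (tsum_nonneg (rateTerm_nonneg Q hK hε α))

theorem hasDerivAt_rateTerm (Q : Measure ℕ) {K ε : ℝ} (hK : 0 ≤ K) (hε : 0 < ε) (j : ℕ) (α : ℝ) :
    HasDerivAt (fun α => rateTerm Q K ε α j) (rateDerivTerm Q K ε α j) α := by
  have hC : 0 < coeffC K ε j := by linarith [one_le_coeffC hK hε j]
  have h := (((Real.hasStrictDerivAt_const_rpow hC α).hasDerivAt.sub_const 1).sub
    ((hasDerivAt_id α).mul_const (Real.log (coeffC K ε j)))).const_mul (Q.real {j})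
  refine h.congr_deriv ?_
  rw [rateDerivTerm]
  ring

theorem summable_rateTerm_and_hasDerivAt_tsum {Q : Measure ℕ} (hQ : Q {0} = 0) {K ε : ℝ}
    (hK : 0 ≤ K) (hε : 0 < ε) {α : ℝ} (hα : ENNReal.ofReal α < momentOrder Q) :
    Summable (rateTerm Q K ε α) ∧
      HasDerivAt (fun α => ∑' j, rateTerm Q K ε α j) (∑' j, rateDerivTerm Q K ε α j) α := by
  obtain ⟨τ, h1, h2, hs⟩ := exists_moment_gt hα
  -- The half-line below `β` contains both `α` and `0`; at `0` every term vanishes, which anchors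
  -- the convergence of the series.
  obtain ⟨β, hβ, hβτ⟩ := exists_between (max_lt h2 (by linarith : (0 : ℝ) < τ))
  have hαβ : α < β := (le_max_left α 0).trans_lt hβ
  have h0β : 0 < β := (le_max_right α 0).trans_lt hβ
  have hu := (summable_coeffC_rpow hQ hK hε (by linarith) hs).mul_left (2 / (τ - β))
  have hz : Summable fun j => rateTerm Q K ε 0 j := by
    simp [rateTerm_zero, summable_zero]
  have hd : ∀ j : ℕ, ∀ y ∈ Set.Iio β,
      HasDerivAt (fun α => rateTerm Q K ε α j) (rateDerivTerm Q K ε y j) y :=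
    fun j y _ => hasDerivAt_rateTerm Q hK hε j y
  have hb : ∀ j : ℕ, ∀ y ∈ Set.Iio β,
      ‖rateDerivTerm Q K ε y j‖ ≤ 2 / (τ - β) * (Q.real {j} * coeffC K ε j ^ τ) :=
    fun j y hy => abs_rateDerivTerm_le Q hK hε (le_of_lt hy) h0β.le hβτ j
  exact ⟨summable_of_summable_hasDerivAt_of_isPreconnected
      (g := fun j α => rateTerm Q K ε α j) (g' := fun j α => rateDerivTerm Q K ε α j)
      hu isOpen_Iio isPreconnected_Iio hd hb h0β hz hαβ,
    hasDerivAt_tsum_of_isPreconnected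
      (g := fun j α => rateTerm Q K ε α j) (g' := fun j α => rateDerivTerm Q K ε α j)
      hu isOpen_Iio isPreconnected_Iio hd hb h0β hz hαβ⟩

theorem hasDerivAt_rateI (lam : ℝ≥0) {Q : Measure ℕ} (hQ : Q {0} = 0) {K ε : ℝ}
    (hK : 0 ≤ K) (hε : 0 < ε) {α : ℝ} (hα : ENNReal.ofReal α < momentOrder Q) :
    HasDerivAt (rateI lam Q K ε) (rateDeriv lam Q K ε α) α :=
  (summable_rateTerm_and_hasDerivAt_tsum hQ hK hε hα).2.const_mul (lam : ℝ)

theorem rateDerivTerm_mono (Q : Measure ℕ) {K ε : ℝ} (hK : 0 ≤ K) (hε : 0 < ε) {a b : ℝ}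
    (hab : a ≤ b) (j : ℕ) : rateDerivTerm Q K ε a j ≤ rateDerivTerm Q K ε b j := by
  have h1 := one_le_coeffC hK hε j
  have := Real.log_nonneg h1
  unfold rateDerivTerm
  gcongr

theorem rateDeriv_mono (lam : ℝ≥0) {Q : Measure ℕ} (hQ : Q {0} = 0) {K ε : ℝ} (hK : 0 ≤ K)
    (hε : 0 < ε) {a b : ℝ} (hb : ENNReal.ofReal b < momentOrder Q) (hab : a ≤ b) :
    rateDeriv lam Q K ε a ≤ rateDeriv lam Q K ε b :=
  mul_le_mul_of_nonneg_left
    ((summable_rateDerivTerm hQ hK hε ((ENNReal.ofReal_le_ofReal hab).trans_lt hb)).tsum_le_tsum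
      (rateDerivTerm_mono Q hK hε hab) (summable_rateDerivTerm hQ hK hε hb)) lam.2

theorem rateDeriv_nonneg (lam : ℝ≥0) {Q : Measure ℕ} (hQ : Q {0} = 0) {K ε : ℝ} (hK : 0 ≤ K)
    (hε : 0 < ε) {a : ℝ} (ha : ENNReal.ofReal a < momentOrder Q) (h0 : 0 ≤ a) :
    0 ≤ rateDeriv lam Q K ε a :=
  (rateDeriv_zero lam Q K ε).symm.le.trans (rateDeriv_mono lam hQ hK hε ha h0)

theorem exists_measureReal_singleton_pos {Q : Measure ℕ} [IsProbabilityMeasure Q]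
    (hQ : Q {0} = 0) : ∃ j : ℕ, 0 < j ∧ 0 < Q.real {j} := by
  by_contra! h
  have hz : ∀ j : ℕ, Q {j} = 0 := fun j => by
    rcases Nat.eq_zero_or_pos j with rfl | hj
    · exact hQ
    · exact (measureReal_eq_zero_iff).1 (le_antisymm (h j hj) measureReal_nonneg)
  have : Q Set.univ = 0 := by
    rw [← Set.iUnion_of_singleton, measure_iUnion_null_iff]
    exact hz
  simp at this

theorem rateDeriv_strictMono {lam : ℝ≥0} (hlam : 0 < lam) {Q : Measure ℕ}
    [IsProbabilityMeasure Q] (hQ : Q {0} = 0) {K ε : ℝ} (hK : 0 < K)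
    (hε : 0 < ε) {a b : ℝ} (hb : ENNReal.ofReal b < momentOrder Q) (hab : a < b) :
    rateDeriv lam Q K ε a < rateDeriv lam Q K ε b := by
  obtain ⟨j, hj, hjQ⟩ := exists_measureReal_singleton_pos hQ
  refine mul_lt_mul_of_pos_left ?_ (NNReal.coe_pos.2 hlam)
  refine (summable_rateDerivTerm hQ hK.le hε
    ((ENNReal.ofReal_le_ofReal hab.le).trans_lt hb)).tsum_lt_tsum
      (rateDerivTerm_mono Q hK.le hε hab.le) (i := j) ?_ (summable_rateDerivTerm hQ hK.le hε hb)
  have h1 : 1 < coeffC K ε j := by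
    have : 0 < j * K / ε := by positivity
    rw [coeffC]
    linarith
  have := Real.log_pos h1
  unfold rateDerivTerm
  gcongr
  exact Real.rpow_lt_rpow_of_exponent_lt h1 hab

theorem rateDerivInv_rateDeriv {lam : ℝ≥0} (hlam : 0 < lam) {Q : Measure ℕ}
    [IsProbabilityMeasure Q] (hQ : Q {0} = 0) {K ε : ℝ} (hK : 0 < K)
    (hε : 0 < ε) {α : ℝ} (h0 : 0 < α) (hα : ENNReal.ofReal α < momentOrder Q) :
    rateDerivInv lam Q K ε (rateDeriv lam Q K ε α) = ENNReal.ofReal α := by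
  refine le_antisymm (iSup₂_le fun a ha => ENNReal.ofReal_le_ofReal ?_)
    (le_iSup₂_of_le α ⟨h0, hα, le_rfl⟩ le_rfl)
  by_contra! h
  exact ha.2.2.not_gt (rateDeriv_strictMono hlam hQ hK hε ha.2.1 h)

/-! ### The Legendre transform as an integral of the inverse -/

theorem intervalIntegrable_rateDeriv (lam : ℝ≥0) {Q : Measure ℕ} (hQ : Q {0} = 0) {K ε : ℝ}
    (hK : 0 ≤ K) (hε : 0 < ε) {α : ℝ} (h0 : 0 ≤ α) (hα : ENNReal.ofReal α < momentOrder Q) :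
    IntervalIntegrable (rateDeriv lam Q K ε) volume 0 α := by
  refine MonotoneOn.intervalIntegrable fun a _ b hb hab => ?_
  rw [Set.uIcc_of_le h0] at hb
  exact rateDeriv_mono lam hQ hK hε ((ENNReal.ofReal_le_ofReal hb.2).trans_lt hα) hab

theorem integral_rateDeriv (lam : ℝ≥0) {Q : Measure ℕ} (hQ : Q {0} = 0) {K ε : ℝ}
    (hK : 0 ≤ K) (hε : 0 < ε) {α : ℝ} (h0 : 0 ≤ α) (hα : ENNReal.ofReal α < momentOrder Q) :
    ∫ a in 0..α, rateDeriv lam Q K ε a = rateI lam Q K ε α := by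
  rw [intervalIntegral.integral_eq_sub_of_hasDerivAt (f := rateI lam Q K ε) (fun a ha => ?_)
    (intervalIntegrable_rateDeriv lam hQ hK hε h0 hα), rateI_zero, sub_zero]
  rw [Set.uIcc_of_le h0] at ha
  exact hasDerivAt_rateI lam hQ hK hε ((ENNReal.ofReal_le_ofReal ha.2).trans_lt hα)

theorem measurableSet_momentRange (Q : Measure ℕ) :
    MeasurableSet {a : ℝ | 0 < a ∧ ENNReal.ofReal a < momentOrder Q} :=
  measurableSet_Ioi.inter (ENNReal.measurable_ofReal measurableSet_Iio)

/-- By monotonicity the sublevel set is an initial segment of `(0, L)`, so its supremum is its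
length. This form allows Tonelli's theorem. -/
theorem rateDerivInv_eq_volume (lam : ℝ≥0) {Q : Measure ℕ} (hQ : Q {0} = 0) {K ε : ℝ}
    (hK : 0 ≤ K) (hε : 0 < ε) (s : ℝ) :
    rateDerivInv lam Q K ε s
      = volume {a : ℝ | (0 < a ∧ ENNReal.ofReal a < momentOrder Q) ∧ rateDeriv lam Q K ε a ≤ s} := by
  apply le_antisymm
  · refine iSup₂_le fun a ha => ?_
    have : Set.Ioc 0 a ⊆
        {a : ℝ | (0 < a ∧ ENNReal.ofReal a < momentOrder Q) ∧ rateDeriv lam Q K ε a ≤ s} :=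
      fun b hb => ⟨⟨hb.1, (ENNReal.ofReal_le_ofReal hb.2).trans_lt ha.2.1⟩,
        (rateDeriv_mono lam hQ hK hε ha.2.1 hb.2).trans ha.2.2⟩
    simpa using measure_mono (μ := volume) this
  · by_cases htop : rateDerivInv lam Q K ε s = ∞
    · simp [htop]
    · have : {a : ℝ | (0 < a ∧ ENNReal.ofReal a < momentOrder Q) ∧ rateDeriv lam Q K ε a ≤ s} ⊆
          Set.Ioc 0 (rateDerivInv lam Q K ε s).toReal := fun a ha => by
        refine ⟨ha.1.1, ?_⟩
        rw [← ENNReal.ofReal_le_iff_le_toReal htop]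
        exact le_iSup₂_of_le (f := fun (a : ℝ) (_ : 0 < a ∧ ENNReal.ofReal a < momentOrder Q ∧
          rateDeriv lam Q K ε a ≤ s) => ENNReal.ofReal a) a ⟨ha.1.1, ha.1.2, ha.2⟩ le_rfl
      refine (measure_mono this).trans ?_
      simp [htop]

theorem volume_Ioc_inter_le {s₀ b : ℝ} (hb : 0 ≤ b) :
    volume {s : ℝ | s ∈ Set.Ioc 0 s₀ ∧ b ≤ s} = ENNReal.ofReal (s₀ - b) := by
  apply le_antisymm
  · refine (measure_mono (t := Set.Icc b s₀) fun s hs => ⟨hs.2, hs.1.2⟩).trans ?_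
    simp
  · rw [← Real.volume_Ioc]
    exact measure_mono fun s hs => ⟨⟨hb.trans_lt hs.1, hs.2⟩, hs.1.le⟩

theorem lintegral_rateDerivInv (lam : ℝ≥0) {Q : Measure ℕ} (hQ : Q {0} = 0) {K ε : ℝ}
    (hK : 0 ≤ K) (hε : 0 < ε) (s₀ : ℝ) :
    ∫⁻ s in Set.Ioc 0 s₀, rateDerivInv lam Q K ε s
      = ∫⁻ a in {a : ℝ | 0 < a ∧ ENNReal.ofReal a < momentOrder Q},
          ENNReal.ofReal (s₀ - rateDeriv lam Q K ε a) := by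
  set D := {a : ℝ | 0 < a ∧ ENNReal.ofReal a < momentOrder Q}
  have hD : MeasurableSet D := measurableSet_momentRange Q
  -- On `D` the function `i` is replaced by `deriv` of `I`, which is measurable on the whole line.
  have hderiv : ∀ a ∈ D, deriv (rateI lam Q K ε) a = rateDeriv lam Q K ε a := fun a ha =>
    (hasDerivAt_rateI lam hQ hK hε ha.2).deriv
  have hmeas : MeasurableSet {p : ℝ × ℝ | deriv (rateI lam Q K ε) p.2 ≤ p.1} :=
    measurableSet_le ((measurable_deriv _).comp measurable_snd) measurable_fst
  have hF : Measurable (Function.uncurry fun s a : ℝ =>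
      {p : ℝ × ℝ | deriv (rateI lam Q K ε) p.2 ≤ p.1}.indicator (1 : ℝ × ℝ → ℝ≥0∞) (s, a)) :=
    measurable_one.indicator hmeas
  calc _ = ∫⁻ s in Set.Ioc 0 s₀, ∫⁻ a in D,
        {p : ℝ × ℝ | deriv (rateI lam Q K ε) p.2 ≤ p.1}.indicator 1 (s, a) := by
        refine lintegral_congr fun s => ?_
        have hm : MeasurableSet {a : ℝ | deriv (rateI lam Q K ε) a ≤ s} :=
          measurableSet_le (measurable_deriv _) measurable_const
        rw [rateDerivInv_eq_volume lam hQ hK hε]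
        have : ∀ a, {p : ℝ × ℝ | deriv (rateI lam Q K ε) p.2 ≤ p.1}.indicator
            (1 : ℝ × ℝ → ℝ≥0∞) (s, a)
            = {a : ℝ | deriv (rateI lam Q K ε) a ≤ s}.indicator 1 a := fun a => rfl
        simp_rw [this]
        rw [lintegral_indicator_one hm, Measure.restrict_apply hm]
        congr 1
        ext a
        constructor
        · rintro ⟨h1, h2⟩
          exact ⟨(hderiv a h1).le.trans h2, h1⟩
        · rintro ⟨h1, h2⟩
          exact ⟨h2, (hderiv a h2).ge.trans h1⟩
    _ = ∫⁻ a in D, ∫⁻ s in Set.Ioc 0 s₀,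
        {p : ℝ × ℝ | deriv (rateI lam Q K ε) p.2 ≤ p.1}.indicator 1 (s, a) :=
        lintegral_lintegral_swap hF.aemeasurable
    _ = _ := by
        refine setLIntegral_congr_fun hD fun a ha => ?_
        have : ∀ s, {p : ℝ × ℝ | deriv (rateI lam Q K ε) p.2 ≤ p.1}.indicator
            (1 : ℝ × ℝ → ℝ≥0∞) (s, a)
            = (Set.Ici (rateDeriv lam Q K ε a)).indicator 1 s := fun s => by
          rw [← hderiv a ha]
          rfl
        simp only [this]
        rw [lintegral_indicator_one measurableSet_Ici, Measure.restrict_apply measurableSet_Ici,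
          ← volume_Ioc_inter_le (rateDeriv_nonneg lam hQ hK hε ha.2 ha.1.le), Set.inter_comm]
        rfl

theorem integral_sub_rateDeriv (lam : ℝ≥0) {Q : Measure ℕ} (hQ : Q {0} = 0) {K ε : ℝ}
    (hK : 0 ≤ K) (hε : 0 < ε) (s₀ : ℝ) {α : ℝ} (h0 : 0 ≤ α)
    (hα : ENNReal.ofReal α < momentOrder Q) :
    IntegrableOn (fun a => s₀ - rateDeriv lam Q K ε a) (Set.Ioc 0 α) ∧
    ∫ a in Set.Ioc 0 α, (s₀ - rateDeriv lam Q K ε a) = α * s₀ - rateI lam Q K ε α := by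
  have hi := intervalIntegrable_rateDeriv lam hQ hK hε h0 hα
  refine ⟨((intervalIntegrable_iff_integrableOn_Ioc_of_le h0).1
    (intervalIntegrable_const.sub hi)), ?_⟩
  rw [← intervalIntegral.integral_of_le h0,
    intervalIntegral.integral_sub intervalIntegrable_const hi,
    integral_rateDeriv lam hQ hK hε h0 hα]
  simp

theorem ofReal_integral_le_lintegral_ofReal {X : Type*} [MeasurableSpace X] {μ : Measure X}
    {f : X → ℝ} (hf : Integrable f μ) :
    ENNReal.ofReal (∫ x, f x ∂μ) ≤ ∫⁻ x, ENNReal.ofReal (f x) ∂μ := by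
  rw [integral_eq_lintegral_pos_part_sub_lintegral_neg_part hf]
  exact (ENNReal.ofReal_le_ofReal (sub_le_self _ ENNReal.toReal_nonneg)).trans
    ENNReal.ofReal_toReal_le

/-- If `i(α) ≤ s₀`, take `β = α`. Otherwise take `β` with `i(β) = s₀`: beyond it the integrand
vanishes. Such a `β` exists by Darboux's theorem, without continuity of `i`. -/
theorem exists_lintegral_le_ofReal (lam : ℝ≥0) {Q : Measure ℕ} (hQ : Q {0} = 0) {K ε : ℝ}
    (hK : 0 ≤ K) (hε : 0 < ε) {s₀ : ℝ} (hs₀ : 0 < s₀) {α : ℝ} (h0 : 0 < α)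
    (hα : ENNReal.ofReal α < momentOrder Q) :
    ∃ β, 0 < β ∧ ENNReal.ofReal β < momentOrder Q ∧
      ∫⁻ a in Set.Ioc 0 α, ENNReal.ofReal (s₀ - rateDeriv lam Q K ε a)
        ≤ ENNReal.ofReal (β * s₀ - rateI lam Q K ε β) := by
  have hle : ∀ β, 0 < β → ENNReal.ofReal β < momentOrder Q → rateDeriv lam Q K ε β ≤ s₀ →
      ∫⁻ a in Set.Ioc 0 β, ENNReal.ofReal (s₀ - rateDeriv lam Q K ε a)
        = ENNReal.ofReal (β * s₀ - rateI lam Q K ε β) := fun β hβ0 hβ hβs => by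
    obtain ⟨h1, h2⟩ := integral_sub_rateDeriv lam hQ hK hε s₀ hβ0.le hβ
    rw [← h2, ofReal_integral_eq_lintegral_ofReal h1]
    refine (ae_restrict_iff' measurableSet_Ioc).2 (.of_forall fun a ha => ?_)
    exact sub_nonneg.2 ((rateDeriv_mono lam hQ hK hε hβ ha.2).trans hβs)
  rcases le_or_gt (rateDeriv lam Q K ε α) s₀ with h | h
  · exact ⟨α, h0, hα, (hle α h0 hα h).le⟩
  · obtain ⟨β, hβ, hβs⟩ := exists_hasDerivWithinAt_eq_of_gt_of_lt h0.le
      (f := rateI lam Q K ε) (f' := rateDeriv lam Q K ε) (m := s₀)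
      (fun a ha => (hasDerivAt_rateI lam hQ hK hε
        ((ENNReal.ofReal_le_ofReal ha.2).trans_lt hα)).hasDerivWithinAt)
      (by rwa [rateDeriv_zero]) h
    have hβL : ENNReal.ofReal β < momentOrder Q := (ENNReal.ofReal_le_ofReal hβ.2.le).trans_lt hα
    refine ⟨β, hβ.1, hβL, ?_⟩
    rw [← hle β hβ.1 hβL hβs.le, ← Set.Ioc_union_Ioc_eq_Ioc hβ.1.le hβ.2.le]
    refine (lintegral_union_le _ _ _).trans ?_
    rw [setLIntegral_congr_fun (g := 0) measurableSet_Ioc (s := Set.Ioc β α) fun a ha => ?_]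
    · simp
    · have := rateDeriv_mono lam hQ hK hε ((ENNReal.ofReal_le_ofReal ha.2).trans_lt hα) ha.1.le
      simp only [Pi.zero_apply, ENNReal.ofReal_eq_zero]
      linarith

/-- Monotone convergence along the countable directed family of intervals with rational right end;
it covers finite and infinite `L` alike. -/
theorem lintegral_momentRange_le {Q : Measure ℕ} {g : ℝ → ℝ≥0∞} {S : ℝ≥0∞}
    (h : ∀ α, 0 < α → ENNReal.ofReal α < momentOrder Q → ∫⁻ a in Set.Ioc 0 α, g a ≤ S) :
    ∫⁻ a in {a : ℝ | 0 < a ∧ ENNReal.ofReal a < momentOrder Q}, g a ≤ S := by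
  let I := {q : ℚ // 0 < (q : ℝ) ∧ ENNReal.ofReal q < momentOrder Q}
  have hsub : {a : ℝ | 0 < a ∧ ENNReal.ofReal a < momentOrder Q} ⊆
      ⋃ q : I, Set.Ioc 0 ((q : ℚ) : ℝ) := fun a ha => by
    obtain ⟨q, hq0, haq, hq⟩ := ENNReal.lt_iff_exists_rat_btwn.1 ha.2
    have haq' : a < q := (ENNReal.ofReal_lt_ofReal_iff_of_nonneg ha.1.le).1 haq
    exact Set.mem_iUnion.2 ⟨⟨q, ha.1.trans haq', hq⟩, ha.1, haq'.le⟩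
  refine (lintegral_mono_set hsub).trans ?_
  have hdir : Directed (· ⊆ ·) fun q : I => Set.Ioc 0 ((q : ℚ) : ℝ) := by
    refine directed_of_isDirected_le (r := (· ⊆ ·)) (f := fun q : I => Set.Ioc 0 ((q : ℚ) : ℝ)) ?_
    intro p q hpq
    exact Set.Ioc_subset_Ioc_right (by exact_mod_cast hpq)
  rw [setLIntegral_iUnion_of_directed _ hdir]
  exact iSup_le fun q => h _ q.2.1 q.2.2

open Filter Topology in
-- Both `I` and its derivative vanish at `0`, so `I(α) < α s₀` for small `α`.
theorem exists_rate_neg (lam : ℝ≥0) {Q : Measure ℕ} (hQ : Q {0} = 0)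
    (hL : 1 < momentOrder Q) {K ε : ℝ} (hK : 0 ≤ K) (hε : 0 < ε) {s₀ : ℝ} (hs₀ : 0 < s₀) :
    ∃ α, 0 < α ∧ ENNReal.ofReal α < momentOrder Q ∧ rateI lam Q K ε α + α * -s₀ < 0 := by
  have h := (hasDerivAt_rateI lam hQ hK hε (α := 0)
    (by simpa using zero_lt_one.trans hL)).tendsto_slope_zero_right
  rw [rateDeriv_zero] at h
  obtain ⟨α, h1, h2⟩ := ((h.eventually_lt_const hs₀).and
    (Ioo_mem_nhdsGT (zero_lt_one' ℝ))).exists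
  refine ⟨α, h2.1, (ENNReal.ofReal_le_one.2 h2.2.le).trans_lt hL, ?_⟩
  rw [zero_add, rateI_zero, sub_zero, smul_eq_mul, inv_mul_lt_iff₀ h2.1] at h1
  linarith

theorem iInf_rate_eq_neg_lintegral (lam : ℝ≥0) {Q : Measure ℕ} (hQ : Q {0} = 0)
    (hL : 1 < momentOrder Q) {K ε : ℝ}
    (hK : 0 ≤ K) (hε : 0 < ε) {s₀ : ℝ} (hs₀ : 0 < s₀) :
    (⨅ (α : ℝ) (_ : 0 < α ∧ ENNReal.ofReal α < momentOrder Q),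
      ((rateI lam Q K ε α + α * -s₀ : ℝ) : EReal))
      = -((∫⁻ s in Set.Ioc 0 s₀, rateDerivInv lam Q K ε s : ℝ≥0∞) : EReal) := by
  rw [lintegral_rateDerivInv lam hQ hK hε]
  set m : EReal := ⨅ (α : ℝ) (_ : 0 < α ∧ ENNReal.ofReal α < momentOrder Q),
      ((rateI lam Q K ε α + α * -s₀ : ℝ) : EReal) with hm
  have hmle : ∀ α, 0 < α → ENNReal.ofReal α < momentOrder Q →
      ((α * s₀ - rateI lam Q K ε α : ℝ) : EReal) ≤ -m := fun α h0 hα => by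
    rw [EReal.le_neg, ← EReal.coe_neg]
    refine (iInf₂_le α ⟨h0, hα⟩).trans_eq ?_
    congr 1
    ring
  apply le_antisymm
  · rw [EReal.le_neg]
    have h : ∫⁻ a in {a : ℝ | 0 < a ∧ ENNReal.ofReal a < momentOrder Q},
        ENNReal.ofReal (s₀ - rateDeriv lam Q K ε a) ≤ (-m).toENNReal := by
      refine lintegral_momentRange_le fun α h0 hα => ?_
      obtain ⟨β, hβ0, hβ, hle⟩ := exists_lintegral_le_ofReal lam hQ hK hε hs₀ h0 hα
      refine hle.trans ?_
      have := EReal.toENNReal_le_toENNReal (hmle β hβ0 hβ)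
      rwa [EReal.toENNReal_of_ne_top (EReal.coe_ne_top _), EReal.toReal_coe] at this
    -- Needed because `toENNReal` sends negative values to `0`.
    have hm0 : 0 ≤ -m := by
      obtain ⟨α, h0, hα, hneg⟩ := exists_rate_neg lam hQ hL hK hε hs₀
      refine le_trans ?_ (hmle α h0 hα)
      exact_mod_cast (by linarith : (0 : ℝ) ≤ α * s₀ - rateI lam Q K ε α)
    rw [← EReal.coe_toENNReal hm0]
    exact_mod_cast h
  · refine le_iInf₂ fun α hα => ?_
    rw [EReal.neg_le, ← EReal.coe_neg]
    obtain ⟨h1, h2⟩ := integral_sub_rateDeriv lam hQ hK hε s₀ hα.1.le hα.2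
    have h3 : ENNReal.ofReal (α * s₀ - rateI lam Q K ε α) ≤
        ∫⁻ a in {a : ℝ | 0 < a ∧ ENNReal.ofReal a < momentOrder Q},
          ENNReal.ofReal (s₀ - rateDeriv lam Q K ε a) := by
      rw [← h2]
      refine (ofReal_integral_le_lintegral_ofReal h1).trans (lintegral_mono_set fun a ha => ?_)
      exact ⟨ha.1, (ENNReal.ofReal_le_ofReal ha.2).trans_lt hα.2⟩
    calc ((-(rateI lam Q K ε α + α * -s₀) : ℝ) : EReal)
        ≤ ((ENNReal.ofReal (α * s₀ - rateI lam Q K ε α) : ℝ≥0∞) : EReal) := by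
          rw [EReal.coe_ennreal_ofReal]
          refine EReal.coe_le_coe_iff.2 (le_trans (le_of_eq (by ring)) (le_max_left _ _))
      _ ≤ _ := by exact_mod_cast h3

/-! ### Lipschitz functions and the tail bound -/

theorem integrable_and_integral_eq_tsum {Q : Measure ℕ} [IsFiniteMeasure Q] {g : ℕ → ℝ}
    (h0 : ∀ j, 0 ≤ g j) (hs : Summable fun j => Q.real {j} * g j) :
    Integrable g Q ∧ ∫ j, g j ∂Q = ∑' j, Q.real {j} * g j := by
  have hl : ∫⁻ j, ENNReal.ofReal (g j) ∂Q = ENNReal.ofReal (∑' j, Q.real {j} * g j) := by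
    rw [lintegral_countable', ENNReal.ofReal_tsum_of_nonneg (fun j => by have := h0 j; positivity) hs]
    refine tsum_congr fun j => ?_
    rw [ENNReal.ofReal_mul measureReal_nonneg, ofReal_measureReal, mul_comm]
  refine ⟨⟨.of_discrete, ?_⟩, ?_⟩
  · rw [hasFiniteIntegral_iff_ofReal (.of_forall h0), hl]
    exact ENNReal.ofReal_lt_top
  · rw [integral_eq_lintegral_of_nonneg_ae (.of_forall h0) .of_discrete, hl,
      ENNReal.toReal_ofReal (tsum_nonneg fun j => by have := h0 j; positivity)]

theorem IsLipschitzNat.nonneg {K : ℝ} {f : ℕ → ℝ} (hf : IsLipschitzNat K f) : 0 ≤ K :=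
  (abs_nonneg _).trans (hf 0)

theorem IsLipschitzNat.abs_sub_le {K : ℝ} {f : ℕ → ℝ} (hf : IsLipschitzNat K f) (x j : ℕ) :
    |f (x + j) - f x| ≤ j * K := by
  induction j with
  | zero => simp
  | succ j ih =>
    have h1 := hf (x + j)
    rw [← add_assoc]
    push_cast
    calc _ = |(f (x + j + 1) - f (x + j)) + (f (x + j) - f x)| := by ring_nf
      _ ≤ _ := abs_add_le _ _
      _ ≤ _ := by linarith

theorem IsLipschitzNat.integrable_compoundPoisson {lam : ℝ≥0} {Q : Measure ℕ}
    [IsProbabilityMeasure Q] (hs : Summable fun j : ℕ => (j : ℝ) * Q.real {j})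
    {K : ℝ} {f : ℕ → ℝ} (hf : IsLipschitzNat K f) :
    Integrable f (compoundPoisson lam Q) ∧
      ∫ z, |f z| ∂(compoundPoisson lam Q) ≤ |f 0| + K * lam * firstMoment Q := by
  have hK := hf.nonneg
  have hq : 0 ≤ firstMoment Q := tsum_nonneg fun j => by positivity
  have hs' : Summable fun j : ℕ => Q.real {j} * ((j : ℝ) * K) :=
    (hs.mul_right K).congr fun j => by ring
  obtain ⟨hi, he⟩ := integrable_and_integral_eq_tsum (fun j : ℕ => (by positivity : 0 ≤ (j : ℝ) * K)) hs'
  have he' : ∫ j : ℕ, (j : ℝ) * K ∂Q = K * firstMoment Q := by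
    rw [he, firstMoment, ← tsum_mul_left]
    exact tsum_congr fun j => by ring
  have hl : ∫⁻ z, ENNReal.ofReal |f z| ∂(compoundPoisson lam Q)
      ≤ ENNReal.ofReal (|f 0| + K * lam * firstMoment Q) := by
    refine (lintegral_compoundPoisson_le lam Q (c := fun j => ENNReal.ofReal ((j : ℝ) * K))
      fun x j => ?_).trans_eq ?_
    · rw [← ENNReal.ofReal_add (abs_nonneg _) (by positivity)]
      refine ENNReal.ofReal_le_ofReal ?_
      linarith [hf.abs_sub_le x j, abs_sub_abs_le_abs_sub (f (x + j)) (f x)]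
    · rw [← ofReal_integral_eq_lintegral_ofReal hi (.of_forall fun j => by positivity), he',
        ← ENNReal.ofReal_coe_nnreal, ← ENNReal.ofReal_mul lam.coe_nonneg,
        ← ENNReal.ofReal_add (abs_nonneg _) (by positivity)]
      congr 1
      ring
  refine ⟨⟨.of_discrete, ?_⟩, ?_⟩
  · rw [hasFiniteIntegral_iff_norm]
    exact hl.trans_lt ENNReal.ofReal_lt_top
  · rw [integral_eq_lintegral_of_nonneg_ae (.of_forall fun _ => abs_nonneg _) .of_discrete]
    exact ENNReal.toReal_le_of_le_ofReal (by positivity) hl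

theorem threshold_pos (lam : ℝ≥0) (Q : Measure ℕ) {K ε : ℝ} (hK : 0 ≤ K) (hε : 0 < ε) (y : ℝ) :
    0 < threshold lam Q K ε y := by
  have hq : 0 ≤ firstMoment Q := tsum_nonneg fun j => by positivity
  rw [threshold]
  positivity

/-- The origin of `T`: the mean deviation is at most `2 E |f(Z)|`, which accounts for both factors
`2`. -/
theorem IsLipschitzNat.integral_abs_sub_integral_le {lam : ℝ≥0} {Q : Measure ℕ}
    [IsProbabilityMeasure Q] (hs : Summable fun j : ℕ => (j : ℝ) * Q.real {j})
    {K : ℝ} {f : ℕ → ℝ} (hf : IsLipschitzNat K f) (ε : ℝ) :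
    ∫ z, (|f z - ∫ y, f y ∂(compoundPoisson lam Q)| + ε) ∂(compoundPoisson lam Q)
      ≤ threshold lam Q K ε (f 0) := by
  obtain ⟨hi, hb⟩ := hf.integrable_compoundPoisson (lam := lam) hs
  set μ := compoundPoisson lam Q
  have h1 : |∫ y, f y ∂μ| ≤ ∫ y, |f y| ∂μ := abs_integral_le_integral_abs
  calc _ ≤ ∫ z, (|f z| + (|∫ y, f y ∂μ| + ε)) ∂μ := by
        refine integral_mono ((hi.sub (integrable_const _)).abs.add (integrable_const _))
          (hi.abs.add (integrable_const _)) fun z => ?_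
        have := abs_sub (f z) (∫ y, f y ∂μ)
        simp only
        linarith
    _ = ∫ z, |f z| ∂μ + (|∫ y, f y ∂μ| + ε) := by
        rw [integral_add hi.abs (integrable_const _)]
        simp
    _ ≤ _ := by
        rw [threshold]
        linarith

/-- Since `a ≥ ε`, `b ≤ a + j K ≤ a (1 + j K / ε)`; the other sign is symmetric. -/
theorem abs_log_sub_log_le {K ε a b : ℝ} {j : ℕ} (hK : 0 ≤ K) (hε : 0 < ε)
    (ha : ε ≤ a) (hb : ε ≤ b) (h : |b - a| ≤ j * K) :
    |Real.log b - Real.log a| ≤ Real.log (coeffC K ε j) := by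
  have key : ∀ {u v : ℝ}, ε ≤ u → ε ≤ v → v - u ≤ j * K →
      Real.log v - Real.log u ≤ Real.log (coeffC K ε j) := fun {u v} hu hv huv => by
    have hC := one_le_coeffC hK hε j
    rw [sub_le_iff_le_add', ← Real.log_mul (by linarith) (by linarith)]
    refine Real.log_le_log (by linarith) ?_
    have : j * K ≤ u * (j * K / ε) := by
      rw [mul_div_assoc', le_div_iff₀ hε, mul_comm u]
      gcongr
    rw [coeffC, mul_add]
    linarith
  rw [abs_le] at h ⊢
  have h1 := key ha hb h.2
  have h2 := key hb ha (by linarith)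
  constructor <;> linarith

theorem compoundPoisson_tail_le {lam : ℝ≥0} (hlam : 0 < lam) {Q : Measure ℕ}
    [IsProbabilityMeasure Q] (hQ : Q {0} = 0) (hL : 1 < momentOrder Q)
    {K : ℝ} {f : ℕ → ℝ} (hf : IsLipschitzNat K f) {t ε : ℝ} (ht : 0 < t) (hε : 0 < ε)
    {α : ℝ} (hα0 : 0 < α) (hα : ENNReal.ofReal α < momentOrder Q) :
    compoundPoisson lam Q {z | t < |f z - ∫ y, f y ∂(compoundPoisson lam Q)|} ≤
      ENNReal.ofReal (Real.exp
        (rateI lam Q K ε α + α * Real.log (threshold lam Q K ε (f 0) / t))) := by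
  have hK := hf.nonneg
  have hs := summable_firstMoment hQ hL
  obtain ⟨hi, -⟩ := hf.integrable_compoundPoisson (lam := lam) hs
  have hGT := hf.integral_abs_sub_integral_le (lam := lam) hs ε
  have hT := threshold_pos lam Q hK hε (f 0)
  set T := threshold lam Q K ε (f 0)
  set μ := compoundPoisson lam Q
  set m := ∫ y, f y ∂μ
  set G : ℕ → ℝ := fun z => |f z - m| + ε with hG
  have hGi : Integrable G μ := (hi.sub (integrable_const _)).abs.add (integrable_const _)
  have hGε : ∀ z, ε ≤ G z := fun z => le_add_of_nonneg_left (abs_nonneg _)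
  have hG0 : ∀ z, 0 < G z := fun z => hε.trans_le (hGε z)
  -- Subtracting `log ε` makes `h` nonnegative, as the moment bound demands; it cancels after
  -- Markov's inequality.
  set h : ℕ → ℝ := fun z => α * (Real.log (G z) - Real.log ε) with hh
  have h0 : ∀ z, 0 ≤ h z := fun z =>
    mul_nonneg hα0.le (sub_nonneg.2 (Real.log_le_log hε (hGε z)))
  -- The tangent to the logarithm at `T` replaces Jensen's inequality and also yields integrability
  -- of `h`.
  have hlog : ∀ z, h z ≤ α * (Real.log T - Real.log ε) + α * (G z / T - 1) := fun z => by
    rw [← mul_add]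
    refine mul_le_mul_of_nonneg_left ?_ hα0.le
    have := Real.log_le_sub_one_of_pos (div_pos (hG0 z) hT)
    rw [Real.log_div (hG0 z).ne' hT.ne'] at this
    linarith
  have hri : Integrable (fun z => G z / T - 1) μ := (hGi.div_const T).sub (integrable_const _)
  have hbi : Integrable (fun z => α * (Real.log T - Real.log ε) + α * (G z / T - 1)) μ :=
    (integrable_const _).add (hri.const_mul α)
  have hhi : Integrable h μ := hbi.mono' .of_discrete (.of_forall fun z => by
    rw [Real.norm_of_nonneg (h0 z)]
    exact hlog z)
  have hhint : ∫ z, h z ∂μ ≤ α * (Real.log T - Real.log ε) := by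
    refine (integral_mono hhi hbi hlog).trans ?_
    rw [integral_add (integrable_const _)
      (hri.const_mul α), integral_const, integral_const_mul,
      integral_sub (hGi.div_const T) (integrable_const _), integral_div]
    have : (∫ z, G z ∂μ) / T ≤ 1 := (div_le_one hT).2 hGT
    simp only [integral_const, probReal_univ, one_smul]
    nlinarith
  have hC : ∀ j, Real.exp (α * Real.log (coeffC K ε j)) = coeffC K ε j ^ α := fun j => by
    rw [Real.rpow_def_of_pos (by linarith [one_le_coeffC hK hε j]), mul_comm]
  have hlip : ∀ x j, |h (x + j) - h x| ≤ α * Real.log (coeffC K ε j) := fun x j => by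
    rw [hh]
    simp only
    rw [← mul_sub, abs_mul, abs_of_pos hα0, sub_sub_sub_cancel_right]
    refine mul_le_mul_of_nonneg_left (abs_log_sub_log_le hK hε (hGε x) (hGε _) ?_) hα0.le
    refine le_trans ?_ (hf.abs_sub_le x j)
    have := abs_abs_sub_abs_le (f (x + j) - m) (f x - m)
    simpa [hG] using this
  obtain ⟨τ, h1τ, hατ, hsτ⟩ := exists_moment_gt hα
  have hCi : Integrable (fun j => Real.exp (α * Real.log (coeffC K ε j))) Q := by
    simp_rw [hC]
    refine (integrable_and_integral_eq_tsum (fun j => ?_) ?_).1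
    · have := one_le_coeffC hK hε j
      positivity
    · refine Summable.of_nonneg_of_le (fun j => ?_) (fun j => ?_)
        (summable_coeffC_rpow hQ hK hε (by linarith) hsτ)
      · have := one_le_coeffC hK hε j
        positivity
      · gcongr
        exact one_le_coeffC hK hε j
  have hI : lam * ∫ j, (Real.exp (α * Real.log (coeffC K ε j)) - 1
      - α * Real.log (coeffC K ε j)) ∂Q = rateI lam Q K ε α := by
    simp_rw [hC]
    rw [rateI, (integrable_and_integral_eq_tsum (fun j => ?_) ?_).2]
    · rfl
    · exact (summable_rateTerm_and_hasDerivAt_tsum hQ hK hε hα).1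
    · rw [← hC]
      linarith [Real.add_one_le_exp (α * Real.log (coeffC K ε j))]
  have hexp := lintegral_exp_compoundPoisson_le hlam Q hCi h0 hlip hhi
  rw [hI] at hexp
  have hsub : {z | t < |f z - m|} ⊆ {z | ENNReal.ofReal (Real.exp (α * (Real.log t - Real.log ε)))
      ≤ ENNReal.ofReal (Real.exp (h z))} := fun z hz => by
    refine ENNReal.ofReal_le_ofReal (Real.exp_le_exp.2 (mul_le_mul_of_nonneg_left ?_ hα0.le))
    have : t ≤ G z := (le_of_lt hz).trans (le_add_of_nonneg_right hε.le)
    linarith [Real.log_le_log ht this]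
  refine (measure_mono hsub).trans ((meas_ge_le_lintegral_div AEMeasurable.of_discrete
    (ENNReal.ofReal_pos.2 (Real.exp_pos _)).ne' ENNReal.ofReal_ne_top).trans ?_)
  refine (ENNReal.div_le_div_right hexp _).trans ?_
  rw [← ENNReal.ofReal_div_of_pos (Real.exp_pos _), ← Real.exp_sub]
  refine ENNReal.ofReal_le_ofReal (Real.exp_le_exp.2 ?_)
  rw [Real.log_div hT.ne' ht.ne']
  linarith

/-! ### Bounds in the extended reals and conclusion -/

/-- Comparing logarithms in `EReal` also covers an infimum equal to `-∞`. -/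
theorem le_exp_iInf {ι : Type*} {p : ι → Prop} {g : ι → ℝ} {x : ℝ≥0∞}
    (h : ∀ i, p i → x ≤ ENNReal.ofReal (Real.exp (g i))) :
    x ≤ EReal.exp (⨅ (i) (_ : p i), (g i : EReal)) := by
  rw [← ENNReal.exp_log x, EReal.exp_le_exp_iff]
  refine le_iInf₂ fun i hi => ?_
  rw [← EReal.exp_le_exp_iff, ENNReal.exp_log]
  exact h i hi

theorem powerBound_lt_one_iff (lam : ℝ≥0) {Q : Measure ℕ} (hQ : Q {0} = 0)
    (hL : 1 < momentOrder Q) {K ε : ℝ} (hK : 0 ≤ K) (hε : 0 < ε) (y : ℝ) {t : ℝ} (ht : 0 < t) :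
    powerBound lam Q K ε y t < 1 ↔ threshold lam Q K ε y < t := by
  have hT := threshold_pos lam Q hK hε y
  rw [powerBound, EReal.exp_lt_one_iff]
  constructor
  · contrapose!
    intro h
    refine le_iInf₂ fun α hα => EReal.coe_nonneg.2 ?_
    have h1 := rateI_nonneg lam Q hK hε α
    have h2 : 0 ≤ Real.log (threshold lam Q K ε y / t) := Real.log_nonneg ((one_le_div ht).2 h)
    have := hα.1
    positivity
  · intro h
    obtain ⟨α, h0, hα, hneg⟩ := exists_rate_neg lam hQ hL hK hε
      (neg_pos.2 (Real.log_neg (div_pos hT ht) ((div_lt_one ht).2 h)))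
    rw [neg_neg] at hneg
    exact (iInf₂_le α ⟨h0, hα⟩).trans_lt (by exact_mod_cast hneg)

theorem powerBound_eq_integralBound (lam : ℝ≥0) {Q : Measure ℕ} (hQ : Q {0} = 0)
    (hL : 1 < momentOrder Q) {K ε : ℝ} (hK : 0 ≤ K) (hε : 0 < ε) {y t : ℝ}
    (h : threshold lam Q K ε y < t) :
    powerBound lam Q K ε y t = integralBound lam Q K ε y t := by
  have hT := threshold_pos lam Q hK hε y
  rw [powerBound, integralBound, ← iInf_rate_eq_neg_lintegral lam hQ hL hK hε
    (Real.log_pos ((one_lt_div hT).2 h)), ← Real.log_inv, inv_div]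

theorem theorem3 {Ω : Type*} [MeasurableSpace Ω] (P : Measure Ω)
    (lam : ℝ≥0) (hlam : 0 < lam)
    (Q : Measure ℕ) [IsProbabilityMeasure Q] (hQ : Q {0} = 0)
    (hL : 1 < momentOrder Q)
    (Z : Ω → ℕ) (hZ : HasLaw Z (compoundPoisson lam Q) P)
    (K : ℝ) (f : ℕ → ℝ) (hf : IsLipschitzNat K f)
    (t ε : ℝ) (ht : 0 < t) (hε : 0 < ε) :
    -- the quantities in the statement are well defined
    (Summable (fun j : ℕ => (j : ℝ) * Q.real {j}) ∧
      Integrable (fun ω => f (Z ω)) P ∧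
      ∀ α : ℝ, 0 < α → ENNReal.ofReal α < momentOrder Q →
        Summable (rateTerm Q K ε α)) ∧
    -- the power-law bound
    P {ω | t < |f (Z ω) - ∫ ω', f (Z ω') ∂P|} ≤ powerBound lam Q K ε (f 0) t ∧
    -- the bound is less than 1 exactly when t > T
    (powerBound lam Q K ε (f 0) t < 1 ↔ threshold lam Q K ε (f 0) < t) ∧
    -- the function i is the derivative of I, and its inverse is the ordinary one
    (∀ α : ℝ, 0 < α → ENNReal.ofReal α < momentOrder Q →
      Summable (rateDerivTerm Q K ε α) ∧
      HasDerivAt (rateI lam Q K ε) (rateDeriv lam Q K ε α) α ∧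
      (0 < K → rateDerivInv lam Q K ε (rateDeriv lam Q K ε α) = ENNReal.ofReal α)) ∧
    -- the integral form of the bound
    (threshold lam Q K ε (f 0) < t →
      powerBound lam Q K ε (f 0) t = integralBound lam Q K ε (f 0) t ∧
      P {ω | t < |f (Z ω) - ∫ ω', f (Z ω') ∂P|} ≤ integralBound lam Q K ε (f 0) t) := by
  have hK := hf.nonneg
  have hs := summable_firstMoment hQ hL
  have hint : ∫ ω, f (Z ω) ∂P = ∫ z, f z ∂(compoundPoisson lam Q) :=
    hZ.integral_comp (f := f) .of_discrete
  have htail : P {ω | t < |f (Z ω) - ∫ ω', f (Z ω') ∂P|} ≤ powerBound lam Q K ε (f 0) t := by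
    rw [hint, hZ.measure_eq (p := fun z => t < |f z - ∫ z, f z ∂(compoundPoisson lam Q)|)
      .of_discrete]
    exact le_exp_iInf fun α hα => compoundPoisson_tail_le hlam hQ hL hf ht hε hα.1 hα.2
  refine ⟨⟨hs, ?_, fun α _ hα => (summable_rateTerm_and_hasDerivAt_tsum hQ hK hε hα).1⟩, htail,
    powerBound_lt_one_iff lam hQ hL hK hε (f 0) ht, fun α h0 hα =>
      ⟨summable_rateDerivTerm hQ hK hε hα, hasDerivAt_rateI lam hQ hK hε hα,
        fun hK' => rateDerivInv_rateDeriv hlam hQ hK' hε h0 hα⟩, fun h => ?_⟩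
  · have hi := (hf.integrable_compoundPoisson (lam := lam) hs).1
    rw [← hZ.map_eq] at hi
    exact hi.comp_aemeasurable hZ.aemeasurable
  · rw [← powerBound_eq_integralBound lam hQ hL hK hε h]
    exact ⟨rfl, htail⟩
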